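/- Let $\Omega\subset\mathbb R^d$ be a convex cone with non-empty interior ($\lambda x\in\Omega$ for all $\lambda>0$, $x\in\Omega$), let $a>0$, let $0\le Q\in L^1(\mathbb S^{d-1},d\sigma)$ be non-zero ($\sigma$ the surface measure), and let $\mu$ be the measure on $\Omega$ given in polar coordinates by $d\mu(r\zeta)=r^{2a-1}\,dr\,Q(\zeta)\,d\sigma(\zeta)$. Let $\mathcal K:\Omega\times\Omega\to\mathbb C$ be continuous, bounded, $|\mathcal K(x,\xi)|\le c_{\mathcal K}$, and homogeneous, $\mathcal K(\lambda x,\xi)=\mathcal K(x,\lambda\xi)$ for all $\lambda>0$. For restrictions $f$ to $\Omega$ of Schwartz functions on $\mathbb R^d$ put $Tf(\xi)=\int_\Omega f(x)\mathcal K(x,\xi)\,d\mu(x)$, assume that Parseval's theorem $\langle Tf,Tg\rangle_{L^2(\Omega,\mu)}=\langle f,g\rangle_{L^2(\Omega,\mu)}$ holds for all such $f,g$, and denote by $T$ also the isometric extension of this operator to $L^2(\Omega,\mu)$. Let $s>0$. Norms $\||x|^sf\|$ and $\||\xi|^sTf\|$ below are norms of $L^2(\Omega,\mu)$ with values in $[0,\infty]$.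 (1) There is a constant $C>0$, depending only on $s$, $a$, $c_{\mathcal K}$ and $\|Q\|_{L^1(\mathbb S^{d-1})}$, such that for every orthonormal sequence $(f_n)_{n\ge1}$ in $L^2(\Omega,\mu)$ and every integer $N\ge1$, $$\sum_{n=1}^N\Big(\big\||x|^sf_n\big\|^2+\big\||\xi|^sTf_n\big\|^2\Big)\ \ge\ C\,N^{1+\frac{s}{2a}} .$$ (2) If $(f_n)_{n\ge1}$ is an orthonormal basis of $L^2(\Omega,\mu)$, then $$\sup_{n\ge1}\Big(\big\||x|^sf_n\big\|\cdot\big\||\xi|^sTf_n\big\|\Big)=\infty .$$ -/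

import Mathlib

open MeasureTheory Set Metric
open scoped ENNReal SchwartzMap ComplexConjugate

/-- The Euclidean space `ℝ^d`. -/
abbrev Euc (d : ℕ) : Type := EuclideanSpace ℝ (Fin d)

/-- The surface (Lebesgue) measure on the unit sphere of `ℝ^d`. -/
noncomputable def sphereMeasure (d : ℕ) : Measure (sphere (0 : Euc d) 1) :=
  (volume : Measure (Euc d)).toSphere

/-- The measure `r^(2a-1) dr` on `(0, ∞)`. -/
noncomputable def radialMeasure (a : ℝ) : Measure (Ioi (0 : ℝ)) :=
  (Measure.comap Subtype.val volume).withDensity fun r => ENNReal.ofReal (r.1 ^ (2 * a - 1))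

/-- The measure on `ℝ^d` given in polar coordinates `x = r ζ` by `r^(2a-1) dr Q(ζ) dσ(ζ)`. -/
noncomputable def polarMeasure {d : ℕ} (a : ℝ) (Q : sphere (0 : Euc d) 1 → ℝ) :
    Measure (Euc d) :=
  (((sphereMeasure d).withDensity fun ζ => ENNReal.ofReal (Q ζ)).prod (radialMeasure a)).map
    fun p => p.2.1 • p.1.1

/-- A convex cone `Ω` with non-empty interior in `ℝ^d`, an exponent `a > 0` and a non-negative,
non-zero, integrable weight `Q` on the unit sphere. -/
structure WeightedCone (d : ℕ) where
  /-- the cone -/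
  Ω : Set (Euc d)
  convex : Convex ℝ Ω
  smul_mem : ∀ lam : ℝ, 0 < lam → ∀ x ∈ Ω, lam • x ∈ Ω
  interior_nonempty : (interior Ω).Nonempty
  /-- half of the degree of homogeneity of the measure -/
  a : ℝ
  a_pos : 0 < a
  /-- the angular density of the measure -/
  Q : sphere (0 : Euc d) 1 → ℝ
  Q_nonneg : ∀ ζ, 0 ≤ Q ζ
  Q_integrable : Integrable Q (sphereMeasure d)
  Q_ne_zero : ¬ Q =ᵐ[sphereMeasure d] 0

namespace WeightedCone

variable {d : ℕ}

/-- The measure `μ` on `Ω` with `dμ(rζ) = r^(2a-1) dr Q(ζ) dσ(ζ)`, seen as a measure on `ℝ^d`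
that is carried by `Ω`. -/
noncomputable def μ (W : WeightedCone d) : Measure (Euc d) :=
  (polarMeasure W.a W.Q).restrict W.Ω

/-- The Hilbert space `L²(Ω, μ)` of complex-valued functions. -/
noncomputable abbrev L2 (W : WeightedCone d) : Type := Lp ℂ 2 W.μ

end WeightedCone

section Measure

variable {d : ℕ}

instance instSigmaFiniteRadial : SigmaFinite (Measure.comap Subtype.val volume :
    Measure (Ioi (0 : ℝ))) := by
  have h : SigmaFinite (Measure.volumeIoiPow 0) := inferInstance
  simpa [Measure.volumeIoiPow] using h

instance instSigmaFiniteRadialMeasure (a : ℝ) : SigmaFinite (radialMeasure a) :=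
  SigmaFinite.withDensity_of_ne_top (by simp)

theorem measurable_polar :
    Measurable fun p : sphere (0 : Euc d) 1 × Ioi (0 : ℝ) => p.2.1 • p.1.1 := by
  fun_prop

theorem polarMeasure_absolutelyContinuous (a : ℝ) (Q : sphere (0 : Euc d) 1 → ℝ) :
    polarMeasure a Q ≪ volume := by
  have h1 : (Measure.comap Subtype.val volume : Measure (Ioi (0 : ℝ))) ≪
      Measure.volumeIoiPow (Module.finrank ℝ (Euc d) - 1) := by
    refine withDensity_absolutelyContinuous' (by fun_prop) (Filter.Eventually.of_forall ?_)
    intro r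
    have : (0 : ℝ) < r.1 := r.2
    simpa using pow_pos this _
  have h2 : ((sphereMeasure d).withDensity fun ζ => ENNReal.ofReal (Q ζ)).prod (radialMeasure a) ≪
      (sphereMeasure d).prod (Measure.volumeIoiPow (Module.finrank ℝ (Euc d) - 1)) :=
    (withDensity_absolutelyContinuous _ _).prod
      ((withDensity_absolutelyContinuous _ _).trans h1)
  have h3 := (volume : Measure (Euc d)).measurePreserving_homeomorphUnitSphereProd.symm
    (homeomorphUnitSphereProd (Euc d)).toMeasurableEquiv
  refine Measure.AbsolutelyContinuous.mk fun s hs h0 => ?_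
  rw [polarMeasure, Measure.map_apply measurable_polar hs]
  refine h2 ?_
  have h4 := h3.measure_preimage (s := Subtype.val ⁻¹' s)
    (measurable_subtype_coe hs).nullMeasurableSet
  rw [comap_subtype_coe_apply (measurableSet_singleton _).compl] at h4
  refine Eq.trans ?_ (h4.trans (measure_mono_null (by simp) h0))
  rfl

theorem polarMeasure_hasTemperateGrowth {a : ℝ} (ha : 0 < a) {Q : sphere (0 : Euc d) 1 → ℝ}
    (hQ : Integrable Q (sphereMeasure d)) : (polarMeasure a Q).HasTemperateGrowth := by
  obtain ⟨n, hn⟩ := exists_nat_gt (2 * a)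
  refine ⟨⟨n, ?_⟩⟩
  have hfin : IsFiniteMeasure ((sphereMeasure d).withDensity fun ζ => ENNReal.ofReal (Q ζ)) :=
    isFiniteMeasure_withDensity_ofReal hQ.2
  have hr : IntegrableOn (fun r : ℝ => r ^ (2 * a - 1) * (1 + r) ^ (-(n : ℝ))) (Ioi 0) := by
    rw [← Ioc_union_Ioi_eq_Ioi zero_le_one, integrableOn_union]
    constructor
    · have h : IntegrableOn (fun r : ℝ => r ^ (2 * a - 1)) (Ioc 0 1) := by
        rw [← intervalIntegrable_iff_integrableOn_Ioc_of_le zero_le_one]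
        exact intervalIntegral.intervalIntegrable_rpow' (by linarith)
      refine Integrable.mono' h (by measurability) ?_
      filter_upwards [ae_restrict_mem measurableSet_Ioc] with r hr
      have h0 : 0 < r := hr.1
      rw [Real.norm_of_nonneg (by positivity)]
      exact mul_le_of_le_one_right (by positivity)
        (Real.rpow_le_one_of_one_le_of_nonpos (by linarith) (by simp))
    · have h : IntegrableOn (fun r : ℝ => r ^ (2 * a - 1 - n)) (Ioi 1) :=
        integrableOn_Ioi_rpow_of_lt (by linarith) one_pos
      refine Integrable.mono' h (by measurability) ?_
      filter_upwards [ae_restrict_mem measurableSet_Ioi] with r hr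
      have h0 : 0 < r := one_pos.trans hr
      rw [Real.norm_of_nonneg (by positivity),
        show 2 * a - 1 - (n : ℝ) = 2 * a - 1 + -(n : ℝ) by ring, Real.rpow_add h0 (2 * a - 1)]
      have hn0 : -(n : ℝ) ≤ 0 := by simp
      exact mul_le_mul_of_nonneg_left
        (Real.rpow_le_rpow_of_nonpos h0 (by linarith) hn0) (by positivity)
  have hrad : Integrable (fun r : Ioi (0 : ℝ) => (1 + r.1) ^ (-(n : ℝ))) (radialMeasure a) := by
    rw [radialMeasure, integrable_withDensity_iff_integrable_smul' (by fun_prop)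
      (ae_of_all _ fun _ => ENNReal.ofReal_lt_top)]
    refine Integrable.congr (f := (fun r : ℝ => r ^ (2 * a - 1) * (1 + r) ^ (-(n : ℝ))) ∘
      Subtype.val) ?_ (Filter.Eventually.of_forall fun r => ?_)
    · rw [← (MeasurableEmbedding.subtype_coe measurableSet_Ioi).integrable_map_iff,
        map_comap_subtype_coe measurableSet_Ioi]
      exact hr
    · have h0 : (0 : ℝ) < r.1 := r.2
      simp only [Function.comp_apply, smul_eq_mul]
      rw [ENNReal.toReal_ofReal (by positivity)]
  rw [polarMeasure, integrable_map_measure (Measurable.aestronglyMeasurable (by fun_prop))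
    measurable_polar.aemeasurable]
  refine (Integrable.mul_prod (integrable_const (1 : ℝ)) hrad).congr
    (Filter.Eventually.of_forall fun p => ?_)
  have h0 : (0 : ℝ) < p.2.1 := p.2.2
  simp [norm_smul, abs_of_pos h0]

namespace WeightedCone

variable (W : WeightedCone d)

theorem nullMeasurableSet : NullMeasurableSet W.Ω (polarMeasure W.a W.Q) :=
  (W.convex.nullMeasurableSet volume).mono_ac (polarMeasure_absolutelyContinuous _ _)

theorem ae_mem : ∀ᵐ x ∂W.μ, x ∈ W.Ω := ae_restrict_mem₀ W.nullMeasurableSet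

instance instHasTemperateGrowth : W.μ.HasTemperateGrowth := by
  obtain ⟨n, hn⟩ := (polarMeasure_hasTemperateGrowth W.a_pos W.Q_integrable).exists_integrable
  exact ⟨⟨n, hn.restrict⟩⟩

instance instIsFiniteMeasureOnCompacts : IsFiniteMeasureOnCompacts W.μ := by
  obtain ⟨n, hn⟩ := W.instHasTemperateGrowth.exists_integrable
  refine ⟨fun s hs => ?_⟩
  obtain ⟨R, hR⟩ := hs.isBounded.exists_pos_norm_le
  refine (measure_mono fun x hx => ?_).trans_lt
    (hn.measure_ge_lt_top (ε := (1 + R) ^ (-(n : ℝ))) (Real.rpow_pos_of_pos (by linarith) _))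
  exact Real.rpow_le_rpow_of_nonpos (by positivity) (by linarith [hR.2 x hx]) (by simp)

end WeightedCone

end Measure

/-- A Fourier-like transform on `Ω`: a continuous, bounded, homogeneous kernel `K` for which
Parseval's theorem holds on the Schwartz functions. -/
structure FourierLike {d : ℕ} (W : WeightedCone d) where
  /-- the kernel; only its values on `Ω × Ω` matter -/
  K : Euc d → Euc d → ℂ
  continuousOn : ContinuousOn (Function.uncurry K) (W.Ω ×ˢ W.Ω)
  bounded : ∃ c : ℝ, ∀ x ∈ W.Ω, ∀ ξ ∈ W.Ω, ‖K x ξ‖ ≤ c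
  homogeneous : ∀ lam : ℝ, 0 < lam → ∀ x ∈ W.Ω, ∀ ξ ∈ W.Ω, K (lam • x) ξ = K x (lam • ξ)
  memLp : ∀ φ : 𝓢(Euc d, ℂ), MemLp (fun ξ => ∫ x, φ x * K x ξ ∂W.μ) 2 W.μ
  parseval : ∀ φ ψ : 𝓢(Euc d, ℂ),
    ∫ ξ, (∫ x, φ x * K x ξ ∂W.μ) * conj (∫ x, ψ x * K x ξ ∂W.μ) ∂W.μ =
      ∫ x, φ x * conj (ψ x) ∂W.μ

namespace FourierLike

variable {d : ℕ} {W : WeightedCone d} (F : FourierLike W)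

/-- The integral transform `T φ (ξ) = ∫_Ω φ(x) K(x, ξ) dμ(x)`. -/
noncomputable def transform (φ : Euc d → ℂ) (ξ : Euc d) : ℂ := ∫ x, φ x * F.K x ξ ∂W.μ

theorem integrable_mul (φ : 𝓢(Euc d, ℂ)) {ξ : Euc d} (hξ : ξ ∈ W.Ω) :
    Integrable (fun x => φ x * F.K x ξ) W.μ := by
  obtain ⟨c, hc⟩ := F.bounded
  refine (memLp_one_iff_integrable.1 (φ.memLp 1 W.μ)).mul_bdd (c := c) ?_ ?_
  · obtain ⟨t, ht, htm, hte⟩ := W.nullMeasurableSet.exists_measurable_subset_ae_eq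
    have hμ : W.μ = (polarMeasure W.a W.Q).restrict t := (Measure.restrict_congr_set hte).symm
    rw [hμ]
    refine ContinuousOn.aestronglyMeasurable ?_ htm
    exact F.continuousOn.comp (f := fun x => (x, ξ)) (by fun_prop) fun x hx => ⟨ht hx, hξ⟩
  · filter_upwards [W.ae_mem] with x hx using hc x hx ξ hξ

/-- `T` as a linear map from the Schwartz functions (restricted to `Ω`) to `L²(Ω, μ)`. -/
noncomputable def transformSchwartz : 𝓢(Euc d, ℂ) →ₗ[ℂ] W.L2 where
  toFun φ := (F.memLp φ).toLp
  map_add' φ ψ := by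
    rw [← MemLp.toLp_add]
    refine MemLp.toLp_congr _ _ ?_
    filter_upwards [W.ae_mem] with ξ hξ
    simp only [add_apply, add_mul, Pi.add_apply]
    exact integral_add (F.integrable_mul φ hξ) (F.integrable_mul ψ hξ)
  map_smul' c φ := by
    rw [RingHom.id_apply, ← MemLp.toLp_const_smul]
    refine MemLp.toLp_congr _ _ (Filter.Eventually.of_forall fun ξ => ?_)
    simp only [smul_apply, Pi.smul_apply, smul_eq_mul, mul_assoc]
    exact integral_const_mul _ _

theorem norm_transformSchwartz (φ : 𝓢(Euc d, ℂ)) :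
    ‖F.transformSchwartz φ‖ = ‖SchwartzMap.toLpCLM ℂ ℂ 2 W.μ φ‖ := by
  have h : inner ℂ (F.transformSchwartz φ) (F.transformSchwartz φ) =
      inner ℂ (φ.toLp 2 W.μ) (φ.toLp 2 W.μ) := by
    rw [SchwartzMap.inner_toL2_toL2_eq φ φ W.μ, L2.inner_def]
    refine Eq.trans (integral_congr_ae ?_) (F.parseval φ φ)
    filter_upwards [(F.memLp φ).coeFn_toLp] with ξ hξ
    change inner ℂ (MemLp.toLp _ (F.memLp φ) ξ) (MemLp.toLp _ (F.memLp φ) ξ) = _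
    rw [hξ]
    rfl
  rw [SchwartzMap.toLpCLM_apply, @norm_eq_sqrt_re_inner ℂ, h, ← @norm_eq_sqrt_re_inner ℂ]

theorem denseRange_schwartz : DenseRange (SchwartzMap.toLpCLM ℂ ℂ 2 W.μ) :=
  SchwartzMap.denseRange_toLpCLM (p := 2) (μ := W.μ) ENNReal.ofNat_ne_top

/-- `T` as an isometry of `L²(Ω, μ)`: the continuous extension of the integral transform from the
Schwartz functions. -/
noncomputable def T : W.L2 →ₗᵢ[ℂ] W.L2 where
  toLinearMap := (F.transformSchwartz.extendOfNorm
    (SchwartzMap.toLpCLM ℂ ℂ 2 W.μ).toLinearMap).toLinearMap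
  norm_map' := by
    refine (denseRange_schwartz (W := W)).induction ?_
      (isClosed_eq (by
        simp only [ContinuousLinearMap.coe_coe]
        fun_prop) continuous_norm)
    rintro _ ⟨φ, rfl⟩
    rw [← F.norm_transformSchwartz]
    exact congrArg norm (LinearMap.extendOfNorm_eq denseRange_schwartz
      ⟨1, fun ψ => by simpa using (F.norm_transformSchwartz ψ).le⟩ φ)

/-- On Schwartz functions, `T` is the integral transform. -/
theorem T_schwartz (φ : 𝓢(Euc d, ℂ)) :
    F.T (SchwartzMap.toLpCLM ℂ ℂ 2 W.μ φ) =ᵐ[W.μ] F.transform φ := by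
  have h : F.T (SchwartzMap.toLpCLM ℂ ℂ 2 W.μ φ) = F.transformSchwartz φ :=
    LinearMap.extendOfNorm_eq denseRange_schwartz
      ⟨1, fun ψ => by simpa using (F.norm_transformSchwartz ψ).le⟩ φ
  rw [h]
  exact (F.memLp φ).coeFn_toLp

end FourierLike

/-- The generalized dispersion `‖|x|^s f‖_{L²(Ω, μ)}`, with value `∞` when `|x|^s f` is not
square-integrable. -/
noncomputable def WeightedCone.dispersion {d : ℕ} (W : WeightedCone d) (s : ℝ) (f : W.L2) : ℝ≥0∞ :=
  eLpNorm (fun x => ((‖x‖ ^ s : ℝ) : ℂ) * f x) 2 W.μ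

/-! Localization to balls on both sides of `T` is a Hilbert-Schmidt operator. Bessel's inequality
for `conj K(·, ξ)` on the ball of radius `r`, integrated over `ξ` in the ball of radius `r'`, bounds
the total localized mass of any orthonormal sequence by a constant times `(r r')^(2a)`
(`sum_ballMass_T_cutoff_le_ofReal`). But a unit vector must have localized mass, or a tail of `f`
beyond `r`, or a tail of `T f` beyond `r'`, and tails are controlled by dispersions
(`one_le_ballMass_add_dispersion`). For (1), sum this over `N` functions with `r = r'` so chosen
that localization accounts for at most half of `N`.

For (2), suppose the products are bounded and let `δ n` be the dispersion of `f n`. The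
Hilbert-Schmidt bound sees only `r r'`, so the number of `δ n` in `[t, 2t)` is bounded uniformly in
`t` (`exists_card_le`), and `∑ min (δ n ^ 2) (δ n ^ -2)` converges. Test the basis against
orthonormal `g j` living in `1 < ‖x‖ ≤ 2`. A small `δ n` makes `⟨f n, g j⟩` small because `g j`
avoids the unit ball; a large `δ n` concentrates `T (f n)` in the unit ball, where the mass of `T (g
j)` tends to `0`. So all but about a quarter of the Parseval sum of `g j` sits on a finite set of
`n` not depending on `j`, while `g j` tends weakly to `0`: a contradiction. -/

/-! ### Measure of balls and shells. -/

/-- The `r^(2a-1) dr`-measure of an interval. -/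
theorem radialMeasure_Ioc {a : ℝ} (ha : 0 < a) {α β : ℝ} (hα : 0 ≤ α) (hαβ : α ≤ β) :
    radialMeasure a (Subtype.val ⁻¹' Ioc α β) =
      ENNReal.ofReal ((β ^ (2 * a) - α ^ (2 * a)) / (2 * a)) := by
  have hsub : Ioc α β ⊆ Ioi (0 : ℝ) := fun x hx => hα.trans_lt hx.1
  rw [radialMeasure, withDensity_apply _ (measurable_subtype_coe measurableSet_Ioc),
    ← (MeasurableEmbedding.subtype_coe measurableSet_Ioi).lintegral_map
      (fun r : ℝ => ENNReal.ofReal (r ^ (2 * a - 1))),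
    ← (MeasurableEmbedding.subtype_coe measurableSet_Ioi).restrict_map,
    (MeasurableEmbedding.subtype_coe measurableSet_Ioi).map_comap, Subtype.range_coe,
    Measure.restrict_restrict measurableSet_Ioc, inter_eq_self_of_subset_left hsub,
    ← ofReal_integral_eq_lintegral_ofReal]
  · rw [← intervalIntegral.integral_of_le hαβ, integral_rpow (Or.inl (by linarith))]
    simp
  · rw [← IntegrableOn, ← intervalIntegrable_iff_integrableOn_Ioc_of_le hαβ]
    exact intervalIntegral.intervalIntegrable_rpow' (by linarith)
  · filter_upwards [ae_restrict_mem measurableSet_Ioc] with r hr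
    exact Real.rpow_nonneg (hsub hr).le _

namespace WeightedCone

variable {d : ℕ} (W : WeightedCone d)

/-- The total mass of the angular part of `μ`. -/
noncomputable def angularMass : ℝ≥0∞ :=
  (sphereMeasure d).withDensity (fun ζ => ENNReal.ofReal (W.Q ζ))
    {ζ | (ζ : Euc d) ∈ interior W.Ω}

theorem angularMass_le : W.angularMass ≤ ENNReal.ofReal (∫ ζ, W.Q ζ ∂(sphereMeasure d)) := by
  refine (measure_mono (subset_univ _)).trans ?_
  rw [withDensity_apply _ MeasurableSet.univ, Measure.restrict_univ,
    ofReal_integral_eq_lintegral_ofReal W.Q_integrable (ae_of_all _ W.Q_nonneg)]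

/-- The boundary of a convex set is Lebesgue-null. The interior is Borel and still a cone, so polar
coordinates factor on it, whereas `Ω` is only null measurable. -/
theorem μ_eq_restrict_interior : W.μ = (polarMeasure W.a W.Q).restrict (interior W.Ω) := by
  refine Measure.restrict_congr_set (Filter.EventuallyLE.antisymm ?_
    (Filter.Eventually.of_forall fun x hx => interior_subset hx))
  have h : (polarMeasure W.a W.Q) (frontier W.Ω) = 0 :=
    polarMeasure_absolutelyContinuous _ _ (W.convex.addHaar_frontier volume)
  have h' : ∀ᵐ x ∂(polarMeasure W.a W.Q), x ∉ frontier W.Ω := compl_mem_ae_iff.2 h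
  filter_upwards [h'] with x hx hxΩ
  by_contra hi
  exact hx ⟨subset_closure hxΩ, hi⟩

theorem smul_mem_interior_iff {lam : ℝ} (h : 0 < lam) (x : Euc d) :
    lam • x ∈ interior W.Ω ↔ x ∈ interior W.Ω := by
  have key : ∀ lam : ℝ, 0 < lam → ∀ x ∈ interior W.Ω, lam • x ∈ interior W.Ω := by
    intro lam h x hx
    rw [mem_interior] at hx ⊢
    obtain ⟨U, hU, hUo, hxU⟩ := hx
    refine ⟨(fun y => lam⁻¹ • y) ⁻¹' U, fun y hy => ?_, hUo.preimage (by fun_prop), ?_⟩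
    · simpa [smul_smul, h.ne'] using W.smul_mem lam h _ (hU hy)
    · simpa [smul_smul, h.ne'] using hxU
  refine ⟨fun hx => ?_, key lam h x⟩
  simpa [smul_smul, h.ne'] using key lam⁻¹ (inv_pos.2 h) _ hx

/-- The measure `μ` of a rotation invariant set. -/
theorem μ_norm_preimage {E : Set ℝ} (hE : MeasurableSet E) :
    W.μ ((fun x => ‖x‖) ⁻¹' E) = W.angularMass * radialMeasure W.a (Subtype.val ⁻¹' E) := by
  have hfin : IsFiniteMeasure ((sphereMeasure d).withDensity fun ζ => ENNReal.ofReal (W.Q ζ)) :=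
    isFiniteMeasure_withDensity_ofReal W.Q_integrable.2
  have hm : MeasurableSet ((fun x : Euc d => ‖x‖) ⁻¹' E) := measurable_norm hE
  rw [W.μ_eq_restrict_interior, Measure.restrict_apply hm, polarMeasure,
    Measure.map_apply measurable_polar (hm.inter isOpen_interior.measurableSet), angularMass,
    ← Measure.prod_prod]
  congr 1
  ext ⟨ζ, r⟩
  have hr : (0 : ℝ) < r.1 := r.2
  simp [norm_smul, abs_of_pos hr, W.smul_mem_interior_iff hr, and_comm]

theorem angularMass_ne_top : W.angularMass ≠ ⊤ :=
  (W.angularMass_le.trans_lt ENNReal.ofReal_lt_top).ne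

theorem μ_singleton_zero : W.μ {0} = 0 := by
  have h : ({0} : Set (Euc d)) = (fun x => ‖x‖) ⁻¹' {0} := by ext; simp
  have h' : (Subtype.val ⁻¹' {0} : Set (Ioi (0 : ℝ))) = ∅ := by
    ext ⟨r, hr⟩
    simpa using (mem_Ioi.1 hr).ne'
  rw [h, W.μ_norm_preimage (measurableSet_singleton _), h']
  simp

theorem ae_ne_zero : ∀ᵐ x ∂W.μ, x ≠ 0 := compl_mem_ae_iff.2 W.μ_singleton_zero

theorem angularMass_ne_zero (h : W.μ ≠ 0) : W.angularMass ≠ 0 := by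
  intro h0
  refine h (Measure.measure_univ_eq_zero.1 ?_)
  have := W.μ_norm_preimage MeasurableSet.univ
  simpa [h0] using this

theorem μ_shell {α β : ℝ} (hα : 0 ≤ α) (hαβ : α ≤ β) :
    W.μ ((fun x => ‖x‖) ⁻¹' Ioc α β) =
      W.angularMass * ENNReal.ofReal ((β ^ (2 * W.a) - α ^ (2 * W.a)) / (2 * W.a)) := by
  rw [W.μ_norm_preimage measurableSet_Ioc, radialMeasure_Ioc W.a_pos hα hαβ]

theorem μ_closedBall_le {q r : ℝ} (hq : (∫ ζ, W.Q ζ ∂(sphereMeasure d)) ≤ q) (hr : 0 ≤ r) :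
    W.μ (closedBall 0 r) ≤ ENNReal.ofReal (q / (2 * W.a) * r ^ (2 * W.a)) := by
  have ha := W.a_pos
  have hq0 : 0 ≤ q := (integral_nonneg W.Q_nonneg).trans hq
  have h : W.μ (closedBall 0 r) ≤ W.μ ((fun x => ‖x‖) ⁻¹' Ioc 0 r) := by
    refine measure_mono_ae ?_
    filter_upwards [W.ae_ne_zero] with x hx hxr
    exact ⟨norm_pos_iff.2 hx, mem_closedBall_zero_iff.1 hxr⟩
  refine h.trans ?_
  rw [W.μ_shell le_rfl hr, Real.zero_rpow (by positivity), sub_zero]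
  refine (mul_le_mul_left (W.angularMass_le.trans (ENNReal.ofReal_le_ofReal hq)) _).trans ?_
  rw [← ENNReal.ofReal_mul hq0]
  refine le_of_eq (congrArg _ (by ring))

end WeightedCone

/-! ### Cutoff to balls. -/

namespace WeightedCone

variable {d : ℕ} (W : WeightedCone d)

/-- Multiplication with the indicator function of the closed ball of radius `r`. -/
noncomputable def cutoff (r : ℝ) (f : W.L2) : W.L2 :=
  ((Lp.memLp f).indicator (s := closedBall 0 r) measurableSet_closedBall).toLp

theorem coeFn_cutoff (r : ℝ) (f : W.L2) :
    W.cutoff r f =ᵐ[W.μ] (closedBall 0 r).indicator f := MemLp.coeFn_toLp _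

/-- The square of the norm of `g` in `L²(Ω ∩ {‖x‖ ≤ r}, μ)`. -/
noncomputable def ballMass (r : ℝ) (g : W.L2) : ℝ≥0∞ :=
  ∫⁻ x in closedBall 0 r, ‖g x‖ₑ ^ 2 ∂W.μ

theorem norm_cutoff_sub_cutoff_le (r : ℝ) (f g : W.L2) :
    ‖W.cutoff r f - W.cutoff r g‖ ≤ ‖f - g‖ := by
  refine Lp.norm_le_norm_of_ae_le ?_
  filter_upwards [W.coeFn_cutoff r f, W.coeFn_cutoff r g, Lp.coeFn_sub f g,
    Lp.coeFn_sub (W.cutoff r f) (W.cutoff r g)] with x h1 h2 h3 h4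
  rw [h4, h3, Pi.sub_apply, Pi.sub_apply, h1, h2]
  by_cases hx : x ∈ closedBall (0 : Euc d) r <;> simp [hx]

theorem cutoff_eq_self {r : ℝ} {f : W.L2} (h : ∀ᵐ x ∂W.μ, r < ‖x‖ → f x = 0) :
    W.cutoff r f = f := by
  refine Lp.ext ?_
  filter_upwards [h, W.coeFn_cutoff r f] with x hx h1
  rw [h1]
  by_cases hxr : x ∈ closedBall (0 : Euc d) r
  · simp [hxr]
  · rw [indicator_of_notMem hxr, hx (by simpa using hxr)]

end WeightedCone

/-! ### Truncated kernels and the Hilbert-Schmidt bound. -/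

namespace FourierLike

variable {d : ℕ} {W : WeightedCone d} (F : FourierLike W)

theorem aestronglyMeasurable_K {ξ : Euc d} (hξ : ξ ∈ W.Ω) :
    AEStronglyMeasurable (fun x => F.K x ξ) W.μ := by
  obtain ⟨t, ht, htm, hte⟩ := W.nullMeasurableSet.exists_measurable_subset_ae_eq
  have hμ : W.μ = (polarMeasure W.a W.Q).restrict t := (Measure.restrict_congr_set hte).symm
  rw [hμ]
  refine ContinuousOn.aestronglyMeasurable ?_ htm
  exact F.continuousOn.comp (f := fun x => (x, ξ)) (by fun_prop) fun x hx => ⟨ht hx, hξ⟩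

theorem memLp_indicator_K (r : ℝ) {ξ : Euc d} (hξ : ξ ∈ W.Ω) :
    MemLp ((closedBall 0 r).indicator fun x => conj (F.K x ξ)) 2 W.μ := by
  rw [memLp_indicator_iff_restrict measurableSet_closedBall]
  have hfin : IsFiniteMeasure (W.μ.restrict (closedBall 0 r)) :=
    ⟨by simpa using (isCompact_closedBall (0 : Euc d) r).measure_lt_top⟩
  obtain ⟨c, hc⟩ := F.bounded
  refine MemLp.of_bound (Complex.continuous_conj.comp_aestronglyMeasurable
    (F.aestronglyMeasurable_K hξ)).restrict c (ae_restrict_of_ae ?_)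
  filter_upwards [W.ae_mem] with x hx
  simpa using hc x hx ξ hξ

open Classical in
/-- The function `conj K(·, ξ)`, cut off at radius `r`, as an element of `L²(Ω, μ)`. -/
noncomputable def kernelVec (r : ℝ) (ξ : Euc d) : W.L2 :=
  if hξ : ξ ∈ W.Ω then (F.memLp_indicator_K r hξ).toLp else 0

theorem coeFn_kernelVec (r : ℝ) {ξ : Euc d} (hξ : ξ ∈ W.Ω) :
    F.kernelVec r ξ =ᵐ[W.μ] (closedBall 0 r).indicator fun x => conj (F.K x ξ) := by
  rw [kernelVec, dif_pos hξ]
  exact MemLp.coeFn_toLp _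

theorem inner_kernelVec (r : ℝ) {ξ : Euc d} (hξ : ξ ∈ W.Ω) (f : W.L2) :
    inner ℂ (F.kernelVec r ξ) f = ∫ x, (closedBall 0 r).indicator f x * F.K x ξ ∂W.μ := by
  rw [L2.inner_def]
  refine integral_congr_ae ?_
  filter_upwards [F.coeFn_kernelVec r hξ] with x hx
  rw [hx]
  by_cases hxr : x ∈ closedBall (0 : Euc d) r <;> simp [hxr]

theorem enorm_kernelVec_sq_le {c : ℝ} (hc : ∀ x ∈ W.Ω, ∀ ξ ∈ W.Ω, ‖F.K x ξ‖ ≤ c) (r : ℝ)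
    (ξ : Euc d) :
    ‖F.kernelVec r ξ‖ₑ ^ 2 ≤ ENNReal.ofReal c ^ 2 * W.μ (closedBall 0 r) := by
  by_cases hξ : ξ ∈ W.Ω
  · have h2 : ‖F.kernelVec r ξ‖ₑ ^ 2 = ∫⁻ x, ‖F.kernelVec r ξ x‖ₑ ^ 2 ∂W.μ := by
      rw [Lp.enorm_def, eLpNorm_eq_lintegral_rpow_enorm_toReal (by simp) (by simp)]
      simp only [ENNReal.toReal_ofNat, ENNReal.rpow_ofNat]
      rw [← ENNReal.rpow_natCast, ← ENNReal.rpow_mul]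
      norm_num
    rw [h2, ← setLIntegral_const, ← lintegral_indicator measurableSet_closedBall]
    refine lintegral_mono_ae ?_
    filter_upwards [F.coeFn_kernelVec r hξ, W.ae_mem] with x hx hxΩ
    rw [hx]
    by_cases hxr : x ∈ closedBall (0 : Euc d) r
    · simp only [hxr, indicator_of_mem]
      gcongr
      rw [← ofReal_norm]
      exact ENNReal.ofReal_le_ofReal (by simpa using hc x hxΩ ξ hξ)
    · simp [hxr]
  · simp [kernelVec, hξ]

/-- Multiplication of a Schwartz function with a smooth cutoff. -/
theorem exists_schwartz_cutoff {r : ℝ} (hr : 0 < r) (φ : 𝓢(Euc d, ℂ)) :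
    ∃ ψ : 𝓢(Euc d, ℂ), (∀ x, ‖x‖ ≤ r → ψ x = φ x) ∧ (∀ x, 2 * r < ‖x‖ → ψ x = 0) ∧
      ∀ x, ‖ψ x‖ ≤ ‖φ x‖ := by
  let b : ContDiffBump (0 : Euc d) := ⟨r, 2 * r, hr, by linarith⟩
  have hb : Function.HasTemperateGrowth (fun x => ((b x : ℝ) : ℂ)) :=
    (b.hasCompactSupport.comp_left (g := ((↑) : ℝ → ℂ)) Complex.ofReal_zero).hasTemperateGrowth
      (Complex.ofRealCLM.contDiff.comp b.contDiff)
  refine ⟨SchwartzMap.smulLeftCLM ℂ (fun x => ((b x : ℝ) : ℂ)) φ, fun x hx => ?_, fun x hx => ?_,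
    fun x => ?_⟩ <;> rw [SchwartzMap.smulLeftCLM_apply_apply hb]
  · rw [b.one_of_mem_closedBall (by simpa using hx)]
    simp
  · rw [b.zero_of_le_dist (by simpa using hx.le)]
    simp
  · rw [norm_smul, Complex.norm_real, Real.norm_of_nonneg b.nonneg]
    exact mul_le_of_le_one_left (norm_nonneg _) b.le_one

/-- For functions supported in a ball, `T` is the integral transform. -/
theorem T_cutoff_ae {r : ℝ} (hr : 0 < r) (f : W.L2) :
    ∀ᵐ ξ ∂W.μ, F.T (W.cutoff r f) ξ = inner ℂ (F.kernelVec r ξ) f := by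
  obtain ⟨u, hu, hlim⟩ := mem_closure_iff_seq_limit.1
    ((denseRange_schwartz (W := W)) (W.cutoff r f))
  -- The approximants must vanish off one common ball, so that the integral transform becomes the
  -- inner product with a fixed `L²` vector and is continuous in `L²`.
  choose φ hφ using hu
  choose ψ hψ1 hψ2 hψ3 using fun n => exists_schwartz_cutoff hr (φ n)
  have hcut := W.coeFn_cutoff r f
  have hlim' : Filter.Tendsto (fun n => SchwartzMap.toLpCLM ℂ ℂ 2 W.μ (ψ n)) Filter.atTop
      (nhds (W.cutoff r f)) := by
    -- Smoothing the cutoff only improves the approximation: nothing changes inside radius `r`, and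
    -- outside it the limit is `0` and `‖ψ n‖ ≤ ‖φ n‖`.
    rw [tendsto_iff_norm_sub_tendsto_zero] at hlim ⊢
    refine squeeze_zero (fun _ => norm_nonneg _) (fun n => ?_) hlim
    rw [← hφ]
    refine Lp.norm_le_norm_of_ae_le ?_
    filter_upwards [(ψ n).coeFn_toLp 2 W.μ, (φ n).coeFn_toLp 2 W.μ, hcut,
      Lp.coeFn_sub ((ψ n).toLp 2 W.μ) (W.cutoff r f),
      Lp.coeFn_sub ((φ n).toLp 2 W.μ) (W.cutoff r f)] with x h1 h2 h3 h4 h5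
    rw [SchwartzMap.toLpCLM_apply, SchwartzMap.toLpCLM_apply, h4, h5, Pi.sub_apply, Pi.sub_apply,
      h1, h2, h3]
    by_cases hx : ‖x‖ ≤ r
    · rw [hψ1 n x hx]
    · simpa [hx] using hψ3 n x
  have hTlim := (F.T.continuous.tendsto _).comp hlim'
  -- A subsequence of the transforms converges almost everywhere; its pointwise limit is then
  -- computed a second time through the kernel.
  obtain ⟨ns, hmono, hae⟩ := (tendstoInMeasure_of_tendsto_Lp hTlim).exists_seq_tendsto_ae
  have hns := hmono.tendsto_atTop
  filter_upwards [hae, W.ae_mem, ae_all_iff.2 fun n => F.T_schwartz (ψ n)] with ξ h1 hξ h2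
  have h3 : Filter.Tendsto (fun n => inner ℂ (F.kernelVec (2 * r) ξ)
      (SchwartzMap.toLpCLM ℂ ℂ 2 W.μ (ψ (ns n)))) Filter.atTop
      (nhds (inner ℂ (F.kernelVec (2 * r) ξ) (W.cutoff r f))) :=
    (tendsto_const_nhds.inner hlim').comp hns
  have h4 : ∀ n, inner ℂ (F.kernelVec (2 * r) ξ) (SchwartzMap.toLpCLM ℂ ℂ 2 W.μ (ψ n)) =
      F.T (SchwartzMap.toLpCLM ℂ ℂ 2 W.μ (ψ n)) ξ := by
    intro n
    rw [h2 n, F.inner_kernelVec _ hξ]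
    refine integral_congr_ae ?_
    filter_upwards [(ψ n).coeFn_toLp 2 W.μ] with x hx
    by_cases hxr : x ∈ closedBall (0 : Euc d) (2 * r)
    · rw [indicator_of_mem hxr, SchwartzMap.toLpCLM_apply, hx]
    · rw [indicator_of_notMem hxr, hψ2 n x (by simpa using hxr)]
  have h5 : inner ℂ (F.kernelVec (2 * r) ξ) (W.cutoff r f) = inner ℂ (F.kernelVec r ξ) f := by
    rw [F.inner_kernelVec _ hξ, F.inner_kernelVec _ hξ]
    refine integral_congr_ae ?_
    filter_upwards [hcut] with x hx
    congr 1
    by_cases hxr : ‖x‖ ≤ 2 * r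
    · rw [indicator_of_mem (by simpa using hxr), hx]
    · have hxr' : ¬ ‖x‖ ≤ r := fun h => hxr (by linarith)
      simp [hxr, hxr']
  rw [← h5]
  refine tendsto_nhds_unique h1 ?_
  simpa only [Function.comp_apply, h4] using h3

/-- The Hilbert-Schmidt bound: time-frequency localization to balls is a Hilbert-Schmidt
operator. -/
theorem sum_ballMass_T_cutoff_le {c : ℝ} (hc : ∀ x ∈ W.Ω, ∀ ξ ∈ W.Ω, ‖F.K x ξ‖ ≤ c) {r : ℝ}
    (hr : 0 < r) (r' : ℝ) {f : ℕ → W.L2} (hf : Orthonormal ℂ f) (u : Finset ℕ) :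
    ∑ n ∈ u, W.ballMass r' (F.T (W.cutoff r (f n))) ≤
      ENNReal.ofReal c ^ 2 * W.μ (closedBall 0 r) * W.μ (closedBall 0 r') := by
  unfold WeightedCone.ballMass
  rw [← lintegral_finsetSum' _ fun n _ =>
    ((Lp.aestronglyMeasurable _).enorm.pow_const 2).restrict, ← setLIntegral_const]
  refine lintegral_mono_ae (ae_restrict_of_ae ?_)
  filter_upwards [ae_all_iff.2 fun n => F.T_cutoff_ae hr (f n)] with ξ hξ
  refine le_trans ?_ (F.enorm_kernelVec_sq_le hc r ξ)
  -- Bessel's inequality, for each fixed frequency `ξ`.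
  have h := hf.sum_inner_products_le (F.kernelVec r ξ) (s := u)
  simp only [hξ, ← ofReal_norm]
  simp only [← ENNReal.ofReal_pow (norm_nonneg _)]
  rw [← ENNReal.ofReal_sum_of_nonneg fun _ _ => by positivity]
  refine ENNReal.ofReal_le_ofReal (le_trans (le_of_eq ?_) h)
  exact Finset.sum_congr rfl fun n _ => by rw [norm_inner_symm]

end FourierLike

/-! ### Dispersion controls the tails. -/

namespace WeightedCone

variable {d : ℕ} (W : WeightedCone d)

theorem ballMass_eq_eLpNorm_sq (r : ℝ) (g : W.L2) :
    W.ballMass r g = eLpNorm g 2 (W.μ.restrict (closedBall 0 r)) ^ 2 := by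
  rw [ballMass, eLpNorm_eq_lintegral_rpow_enorm_toReal (by simp) (by simp)]
  simp only [ENNReal.toReal_ofNat, ENNReal.rpow_ofNat]
  rw [← ENNReal.rpow_natCast, ← ENNReal.rpow_mul]
  norm_num

theorem enorm_cutoff (r : ℝ) (g : W.L2) :
    ‖W.cutoff r g‖ₑ = eLpNorm g 2 (W.μ.restrict (closedBall 0 r)) := by
  rw [Lp.enorm_def, eLpNorm_congr_ae (W.coeFn_cutoff r g),
    eLpNorm_indicator_eq_eLpNorm_restrict measurableSet_closedBall]

theorem ballMass_eq_enorm_cutoff_sq (r : ℝ) (g : W.L2) :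
    W.ballMass r g = ‖W.cutoff r g‖ₑ ^ 2 := by
  rw [enorm_cutoff, ballMass_eq_eLpNorm_sq]

theorem ballMass_ne_top (r : ℝ) (g : W.L2) : W.ballMass r g ≠ ⊤ := by
  rw [ballMass_eq_enorm_cutoff_sq]
  exact ENNReal.pow_ne_top enorm_ne_top

theorem toReal_ballMass (r : ℝ) (g : W.L2) :
    (W.ballMass r g).toReal = ‖W.cutoff r g‖ ^ 2 := by
  rw [ballMass_eq_enorm_cutoff_sq, ENNReal.toReal_pow, toReal_enorm]

/-- Chebyshev's argument: `1 ≤ r^(-s) ‖x‖^s` outside the ball. -/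
theorem enorm_sub_cutoff_le {r : ℝ} (hr : 0 < r) {s : ℝ} (hs : 0 < s) (g : W.L2) :
    ‖g - W.cutoff r g‖ₑ ≤ ENNReal.ofReal (r ^ (-s)) * W.dispersion s g := by
  rw [Lp.enorm_def, dispersion]
  refine eLpNorm_le_mul_eLpNorm_of_ae_le_mul ?_ 2
  filter_upwards [Lp.coeFn_sub g (W.cutoff r g), W.coeFn_cutoff r g] with x h1 h2
  rw [h1, Pi.sub_apply, h2]
  by_cases hx : ‖x‖ ≤ r
  · rw [indicator_of_mem (by simpa using hx), sub_self, norm_zero]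
    positivity
  · rw [indicator_of_notMem (by simpa using hx), sub_zero, norm_mul, Complex.norm_real,
      Real.norm_of_nonneg (by positivity), ← mul_assoc, Real.rpow_neg hr.le, ← div_eq_inv_mul]
    refine le_mul_of_one_le_left (norm_nonneg _) ((one_le_div (by positivity)).2 ?_)
    exact Real.rpow_le_rpow hr.le (not_le.1 hx).le hs.le

theorem norm_sub_cutoff_le {r : ℝ} (hr : 0 < r) {s : ℝ} (hs : 0 < s) {g : W.L2} {δ : ℝ}
    (hδ : 0 ≤ δ) (h : W.dispersion s g ≤ ENNReal.ofReal δ) :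
    ‖g - W.cutoff r g‖ ≤ r ^ (-s) * δ := by
  have h1 := (W.enorm_sub_cutoff_le hr hs g).trans (mul_le_mul_right h _)
  rw [← ENNReal.ofReal_mul (by positivity), ← ofReal_norm,
    ENNReal.ofReal_le_ofReal_iff (by positivity)] at h1
  exact h1

theorem dispersion_ne_zero (s : ℝ) {f : W.L2} (hf : f ≠ 0) : W.dispersion s f ≠ 0 := by
  intro h
  rw [dispersion, eLpNorm_eq_zero_iff (by
    have := Lp.aestronglyMeasurable f
    have h2 : Measurable fun x : Euc d => ((‖x‖ ^ s : ℝ) : ℂ) := by fun_prop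
    exact h2.aestronglyMeasurable.mul this) (by simp)] at h
  refine hf ((Lp.eq_zero_iff_ae_eq_zero).2 ?_)
  filter_upwards [h, W.ae_ne_zero] with x hx h0
  have : 0 < ‖x‖ ^ s := Real.rpow_pos_of_pos (norm_pos_iff.2 h0) _
  simpa [this.ne'] using hx

end WeightedCone

theorem ENNReal.one_le_three_mul_sum_sq {x y z : ℝ≥0∞} (h : 1 ≤ x + y + z) :
    1 ≤ 3 * (x ^ 2 + y ^ 2 + z ^ 2) := by
  by_cases hx : x = ⊤
  · simp [hx]
  by_cases hy : y = ⊤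
  · simp [hy]
  by_cases hz : z = ⊤
  · simp [hz]
  lift x to NNReal using hx
  lift y to NNReal using hy
  lift z to NNReal using hz
  norm_cast at h ⊢
  have h' : (1 : ℝ) ≤ x + y + z := by exact_mod_cast h
  have : (1 : ℝ) ≤ 3 * (x ^ 2 + y ^ 2 + z ^ 2) := by
    nlinarith [sq_nonneg ((x : ℝ) - y), sq_nonneg ((y : ℝ) - z), sq_nonneg ((x : ℝ) - z)]
  exact_mod_cast this

/-! ### The lower bound for sums of dispersions. -/

namespace FourierLike

variable {d : ℕ} {W : WeightedCone d} (F : FourierLike W)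

/-- A normalized function is controlled by its time-frequency localization and its dispersions. -/
theorem one_le_ballMass_add_dispersion {r r' s : ℝ} (hr : 0 < r) (hr' : 0 < r') (hs : 0 < s)
    {f : W.L2} (hf : ‖f‖ = 1) :
    1 ≤ 3 * (W.ballMass r' (F.T (W.cutoff r f)) +
      (ENNReal.ofReal (r ^ (-s)) * W.dispersion s f) ^ 2 +
      (ENNReal.ofReal (r' ^ (-s)) * W.dispersion s (F.T f)) ^ 2) := by
  rw [W.ballMass_eq_enorm_cutoff_sq]
  refine ENNReal.one_le_three_mul_sum_sq ?_
  have h1 : ‖F.T f‖ ≤ ‖W.cutoff r' (F.T (W.cutoff r f))‖ + ‖f - W.cutoff r f‖ +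
      ‖F.T f - W.cutoff r' (F.T f)‖ := by
    have h2 := W.norm_cutoff_sub_cutoff_le r' (F.T f) (F.T (W.cutoff r f))
    rw [← map_sub, F.T.norm_map] at h2
    have h3 : F.T f = W.cutoff r' (F.T (W.cutoff r f)) +
      (W.cutoff r' (F.T f) - W.cutoff r' (F.T (W.cutoff r f))) +
        (F.T f - W.cutoff r' (F.T f)) := by abel
    calc ‖F.T f‖ = _ := congrArg norm h3
      _ ≤ _ := norm_add₃_le
      _ ≤ _ := by gcongr
  rw [F.T.norm_map, hf] at h1
  have h4 := ENNReal.ofReal_le_ofReal h1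
  rw [ENNReal.ofReal_add (by positivity) (by positivity),
    ENNReal.ofReal_add (by positivity) (by positivity), ofReal_norm, ofReal_norm, ofReal_norm,
    ENNReal.ofReal_one] at h4
  refine h4.trans ?_
  gcongr
  · exact W.enorm_sub_cutoff_le hr hs f
  · exact W.enorm_sub_cutoff_le hr' hs (F.T f)

/-- The Hilbert-Schmidt bound with the measures of the balls evaluated. -/
theorem sum_ballMass_T_cutoff_le_ofReal {c q : ℝ} (hc : ∀ x ∈ W.Ω, ∀ ξ ∈ W.Ω, ‖F.K x ξ‖ ≤ c)
    (hc0 : 0 ≤ c) (hq : (∫ ζ, W.Q ζ ∂(sphereMeasure d)) ≤ q) {r r' : ℝ} (hr : 0 < r) (hr' : 0 < r')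
    {f : ℕ → W.L2} (hf : Orthonormal ℂ f) (u : Finset ℕ) :
    ∑ n ∈ u, W.ballMass r' (F.T (W.cutoff r (f n))) ≤
      ENNReal.ofReal ((c * (q / (2 * W.a))) ^ 2 * (r * r') ^ (2 * W.a)) := by
  have ha := W.a_pos
  have hq0 : 0 ≤ q := (integral_nonneg W.Q_nonneg).trans hq
  refine (F.sum_ballMass_T_cutoff_le hc hr r' hf u).trans ?_
  refine (mul_le_mul' (mul_le_mul' le_rfl (W.μ_closedBall_le hq hr.le))
    (W.μ_closedBall_le hq hr'.le)).trans ?_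
  rw [← ENNReal.ofReal_pow hc0, ← ENNReal.ofReal_mul (by positivity),
    ← ENNReal.ofReal_mul (by positivity), Real.mul_rpow hr.le hr'.le]
  exact le_of_eq (congrArg _ (by ring))

/-- The quantitative uncertainty principle for orthonormal sequences. -/
theorem le_sum_dispersion_sq {s c q : ℝ} (hs : 0 < s)
    (hc : ∀ x ∈ W.Ω, ∀ ξ ∈ W.Ω, ‖F.K x ξ‖ ≤ c) (hc0 : 0 < c)
    (hq : (∫ ζ, W.Q ζ ∂(sphereMeasure d)) ≤ q) (hq0 : 0 < q)
    {f : ℕ → W.L2} (hf : Orthonormal ℂ f) {N : ℕ} (hN : 1 ≤ N) :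
    ENNReal.ofReal ((6 * (c * (q / (2 * W.a))) ^ 2) ^ (-(s / (2 * W.a))) / 6 *
        (N : ℝ) ^ (1 + s / (2 * W.a))) ≤
      ∑ n ∈ Finset.range N, (W.dispersion s (f n) ^ 2 + W.dispersion s (F.T (f n)) ^ 2) := by
  have ha := W.a_pos
  have hN0 : (0 : ℝ) < N := by exact_mod_cast hN
  -- With `r^(4a) = N / D` the Hilbert-Schmidt bound equals `N / 6`; after the factor `3` it uses up
  -- half of `N`, and the tails must supply the rest.
  set D : ℝ := 6 * (c * (q / (2 * W.a))) ^ 2 with hD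
  have hD0 : 0 < D := by positivity
  set r : ℝ := (N / D) ^ (1 / (4 * W.a)) with hr
  have hr0 : 0 < r := by positivity
  set S := ∑ n ∈ Finset.range N, (W.dispersion s (f n) ^ 2 + W.dispersion s (F.T (f n)) ^ 2)
    with hS
  have h1 := F.sum_ballMass_T_cutoff_le_ofReal hc hc0.le hq hr0 hr0 hf (Finset.range N)
  have hrr : (r * r) ^ (2 * W.a) = N / D := by
    rw [← sq, ← Real.rpow_natCast, ← Real.rpow_mul hr0.le, hr, ← Real.rpow_mul (by positivity)]
    rw [show 1 / (4 * W.a) * (((2 : ℕ) : ℝ) * (2 * W.a)) = 1 by push_cast; field_simp; norm_num,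
      Real.rpow_one]
  have h2 : (N : ℝ≥0∞) ≤ 3 * (ENNReal.ofReal (N / 6) + ENNReal.ofReal (r ^ (-s)) ^ 2 * S) := by
    calc (N : ℝ≥0∞) = ∑ n ∈ Finset.range N, 1 := by simp
      _ ≤ _ := Finset.sum_le_sum fun n _ =>
        F.one_le_ballMass_add_dispersion hr0 hr0 hs (hf.norm_eq_one n)
      _ = 3 * (∑ n ∈ Finset.range N, W.ballMass r (F.T (W.cutoff r (f n))) +
          ENNReal.ofReal (r ^ (-s)) ^ 2 * S) := by
        rw [hS, Finset.mul_sum _ _ (ENNReal.ofReal (r ^ (-s)) ^ 2), ← Finset.sum_add_distrib,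
          Finset.mul_sum]
        exact Finset.sum_congr rfl fun n _ => by ring
      _ ≤ _ := by
        gcongr
        refine h1.trans (ENNReal.ofReal_le_ofReal (le_of_eq ?_))
        rw [hrr, hD]
        field_simp
  by_cases hST : S = ⊤
  · rw [hST]
    exact le_top
  rw [← ENNReal.ofReal_toReal hST] at h2 ⊢
  refine ENNReal.ofReal_le_ofReal ?_
  rw [← ENNReal.ofReal_pow (by positivity), ← ENNReal.ofReal_mul (by positivity),
    ← ENNReal.ofReal_add (by positivity) (by positivity), ← ENNReal.ofReal_natCast,
    show (3 : ℝ≥0∞) = ENNReal.ofReal 3 by simp, ← ENNReal.ofReal_mul (by positivity),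
    ENNReal.ofReal_le_ofReal_iff (by positivity)] at h2
  have hrs : (r ^ (-s)) ^ 2 = (N / D) ^ (-(s / (2 * W.a))) := by
    rw [← Real.rpow_natCast, ← Real.rpow_mul hr0.le, hr, ← Real.rpow_mul (by positivity)]
    congr 1
    push_cast
    field_simp
    norm_num
  rw [hrs, Real.rpow_neg (by positivity), Real.div_rpow hN0.le hD0.le, inv_div] at h2
  rw [Real.rpow_add hN0, Real.rpow_one, Real.rpow_neg hD0.le]
  have hND : 0 < (N : ℝ) ^ (s / (2 * W.a)) := by positivity
  have hDD : 0 < D ^ (s / (2 * W.a)) := by positivity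
  have h3 : (N : ℝ) / 6 ≤ D ^ (s / (2 * W.a)) / N ^ (s / (2 * W.a)) * S.toReal := by linarith
  rw [div_mul_eq_mul_div, le_div_iff₀ hND] at h3
  calc (D ^ (s / (2 * W.a)))⁻¹ / 6 * (N * N ^ (s / (2 * W.a)))
      = (D ^ (s / (2 * W.a)))⁻¹ * (N / 6 * N ^ (s / (2 * W.a))) := by ring
    _ ≤ (D ^ (s / (2 * W.a)))⁻¹ * (D ^ (s / (2 * W.a)) * S.toReal) := by gcongr
    _ = S.toReal := by field_simp

end FourierLike

/-! ### Unbounded uncertainty products for bases. -/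

/-- If boundedly many terms of a positive sequence lie in each interval `[t, 2t)`, then
`∑ min (d n ^ 2) (d n ^ -2)` converges. -/
theorem summable_min_sq_inv_sq {δ : ℕ → ℝ} (hδ : ∀ n, 0 < δ n) {B : ℝ}
    (h : ∀ t : ℝ, 0 < t → ∀ u : Finset ℕ, (∀ n ∈ u, t ≤ δ n ∧ δ n < 2 * t) → (u.card : ℝ) ≤ B) :
    Summable fun n => min (δ n ^ 2) ((δ n)⁻¹ ^ 2) := by
  -- Majorant on the dyadic level `2^k ≤ δ < 2^(k+1)`; the factor `4` is needed for negative `k`,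
  -- where only the upper end bounds `δ ^ 2`.
  let b : ℤ → ℝ := fun k => 4 * (1 / 4) ^ k.natAbs
  have hb : Summable b := by
    have hg := summable_geometric_of_lt_one (r := (1 / 4 : ℝ)) (by norm_num) (by norm_num)
    refine Summable.mul_left 4 (Summable.of_nat_of_neg ?_ ?_) <;> simpa using hg
  let κ : ℕ → ℤ := fun n => Int.log 2 (δ n)
  have hle : ∀ n, (2 : ℝ) ^ κ n ≤ δ n := fun n => by
    simpa using Int.zpow_log_le_self (b := 2) (by norm_num) (hδ n)
  have hlt : ∀ n, δ n < 2 * (2 : ℝ) ^ κ n := fun n => by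
    have := Int.lt_zpow_succ_log_self (b := 2) (by norm_num) (δ n)
    rw [zpow_add_one₀ (by norm_num)] at this
    simpa [mul_comm] using this
  have hmin : ∀ n, min (δ n ^ 2) ((δ n)⁻¹ ^ 2) ≤ b (κ n) := by
    intro n
    have h1 := hle n
    have h2 := hlt n
    have h0 := hδ n
    rcases Int.natAbs_eq (κ n) with hk | hk
    · refine (min_le_right _ _).trans ?_
      rw [hk, zpow_natCast] at h1
      have h3 : (δ n)⁻¹ ≤ ((2 : ℝ) ^ (κ n).natAbs)⁻¹ := inv_anti₀ (by positivity) h1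
      calc (δ n)⁻¹ ^ 2 ≤ (((2 : ℝ) ^ (κ n).natAbs)⁻¹) ^ 2 := by gcongr
        _ = (1 / 4) ^ (κ n).natAbs := by
          rw [← inv_pow, ← pow_mul, mul_comm, pow_mul]
          norm_num
        _ ≤ b (κ n) := le_mul_of_one_le_left (by positivity) (by norm_num)
    · refine (min_le_left _ _).trans ?_
      rw [hk, zpow_neg, zpow_natCast] at h2
      calc δ n ^ 2 ≤ (2 * ((2 : ℝ) ^ (κ n).natAbs)⁻¹) ^ 2 := by gcongr
        _ = b (κ n) := by
          rw [mul_pow, ← inv_pow, ← pow_mul, mul_comm _ 2, pow_mul]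
          norm_num [b]
  have hb0 : ∀ k, 0 ≤ b k := fun k => by positivity
  refine summable_of_sum_le (c := B * ∑' k, b k) (fun n => by positivity) fun u => ?_
  calc ∑ n ∈ u, min (δ n ^ 2) ((δ n)⁻¹ ^ 2) ≤ ∑ n ∈ u, b (κ n) :=
        Finset.sum_le_sum fun n _ => hmin n
    _ = ∑ k ∈ u.image κ, (u.filter fun n => κ n = k).card • b k := Finset.sum_comp b κ
    _ ≤ ∑ k ∈ u.image κ, B * b k := by
        refine Finset.sum_le_sum fun k _ => ?_
        rw [nsmul_eq_mul]
        refine mul_le_mul_of_nonneg_right (h (2 ^ k) (by positivity) _ fun n hn => ?_) (hb0 k)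
        rw [← (Finset.mem_filter.1 hn).2]
        exact ⟨hle n, hlt n⟩
    _ ≤ B * ∑' k, b k := by
        rw [← Finset.mul_sum]
        have hB : 0 ≤ B := by simpa using h 1 one_pos ∅ (by simp)
        exact mul_le_mul_of_nonneg_left (hb.sum_le_tsum _ fun k _ => hb0 k) hB

namespace WeightedCone

variable {d : ℕ} (W : WeightedCone d)

/-- There is an infinite orthonormal sequence supported in the shell `1 < ‖x‖ ≤ 2`. -/
theorem exists_orthonormal_shell (h : W.μ ≠ 0) :
    ∃ g : ℕ → W.L2, Orthonormal ℂ g ∧ ∀ j, ∀ᵐ x ∂W.μ, g j x ≠ 0 → 1 < ‖x‖ ∧ ‖x‖ ≤ 2 := by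
  have ha := W.a_pos
  -- Radii increasing from `1` towards `2`; the normalized indicators of the successive disjoint
  -- shells are orthonormal.
  let α : ℕ → ℝ := fun j => 2 - 1 / (j + 1)
  have hα1 : ∀ j, 1 ≤ α j := fun j => by
    have : 1 / ((j : ℝ) + 1) ≤ 1 := (div_le_one (by positivity)).2 (by simp)
    simp only [α]
    linarith
  have hα2 : ∀ j, α j ≤ 2 := fun j => by
    have : 0 < 1 / ((j : ℝ) + 1) := by positivity
    simp only [α]
    linarith
  have hmono : StrictMono α := strictMono_nat_of_lt_succ fun j => by
    have : 1 / (((j + 1 : ℕ) : ℝ) + 1) < 1 / ((j : ℝ) + 1) :=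
      one_div_lt_one_div_of_lt (by positivity) (by push_cast; linarith)
    simp only [α]
    linarith
  let S : ℕ → Set (Euc d) := fun j => (fun x => ‖x‖) ⁻¹' Ioc (α j) (α (j + 1))
  have hS : ∀ j, MeasurableSet (S j) := fun j => measurable_norm measurableSet_Ioc
  have hμ : ∀ j, W.μ (S j) = W.angularMass *
      ENNReal.ofReal ((α (j + 1) ^ (2 * W.a) - α j ^ (2 * W.a)) / (2 * W.a)) := fun j =>
    W.μ_shell (by linarith [hα1 j]) (hmono j.lt_succ_self).le
  have htop : ∀ j, W.μ (S j) ≠ ⊤ := fun j => by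
    rw [hμ]
    exact ENNReal.mul_ne_top W.angularMass_ne_top ENNReal.ofReal_ne_top
  have hne : ∀ j, W.μ (S j) ≠ 0 := fun j => by
    rw [hμ]
    refine mul_ne_zero (W.angularMass_ne_zero h) (ne_of_gt (ENNReal.ofReal_pos.2 ?_))
    have := Real.rpow_lt_rpow (by linarith [hα1 j]) (hmono j.lt_succ_self)
      (show 0 < 2 * W.a by positivity)
    exact div_pos (sub_pos.2 this) (by positivity)
  have hpos : ∀ j, 0 < W.μ.real (S j) := fun j => ENNReal.toReal_pos (hne j) (htop j)
  have hdisj : ∀ i j, i ≠ j → S i ∩ S j = ∅ := fun i j hij => by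
    have := hmono.monotone.pairwise_disjoint_on_Ioc_succ hij
    exact (this.preimage _).inter_eq
  refine ⟨fun j => indicatorConstLp 2 (hS j) (htop j) (((Real.sqrt (W.μ.real (S j)))⁻¹ : ℝ) : ℂ),
    ?_, fun j => ?_⟩
  · rw [orthonormal_iff_ite]
    intro i j
    rw [L2.inner_indicatorConstLp_indicatorConstLp (hS i) (hS j) (htop i) (htop j)]
    split_ifs with hij
    · subst hij
      rw [inter_self, inner_self_eq_norm_sq_to_K, Complex.norm_real, Complex.real_smul]
      have h1 := Real.sq_sqrt (hpos i).le
      have h2 := Real.sqrt_pos.2 (hpos i)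
      rw [Real.norm_of_nonneg (by positivity)]
      norm_cast
      rw [inv_pow, h1]
      exact (Complex.ofReal_mul _ _).symm.trans
        (congrArg Complex.ofReal (mul_inv_cancel₀ (hpos i).ne'))
    · simp [hdisj i j hij]
  · filter_upwards [indicatorConstLp_coeFn (p := 2) (hs := hS j) (hμs := htop j)
      (c := (((Real.sqrt (W.μ.real (S j)))⁻¹ : ℝ) : ℂ))] with x hx hx0
    rw [hx] at hx0
    have hxS : x ∈ S j := by
      by_contra hxS
      exact hx0 (indicator_of_notMem hxS _)
    exact ⟨(hα1 j).trans_lt hxS.1, hxS.2.trans (hα2 _)⟩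

theorem inner_cutoff_eq_zero {r : ℝ} {g : W.L2} (hg : ∀ᵐ x ∂W.μ, g x ≠ 0 → r < ‖x‖) (f : W.L2) :
    inner ℂ g (W.cutoff r f) = 0 := by
  rw [L2.inner_def]
  refine integral_eq_zero_of_ae ?_
  filter_upwards [hg, W.coeFn_cutoff r f] with x h1 h2
  rw [h2]
  by_cases hx : g x = 0
  · simp [hx]
  · simp [h1 hx]

theorem inner_cutoff_comm (r : ℝ) (f g : W.L2) :
    inner ℂ (W.cutoff r f) g = inner ℂ f (W.cutoff r g) := by
  rw [L2.inner_def, L2.inner_def]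
  refine integral_congr_ae ?_
  filter_upwards [W.coeFn_cutoff r f, W.coeFn_cutoff r g] with x h1 h2
  rw [h1, h2]
  by_cases hx : x ∈ closedBall (0 : Euc d) r <;> simp [hx]

end WeightedCone

namespace FourierLike

variable {d : ℕ} {W : WeightedCone d} (F : FourierLike W)

/-- Few members of an orthonormal sequence with bounded uncertainty products have a dispersion of
a given size. -/
theorem exists_card_le {s A : ℝ} (hs : 0 < s) (hA : 0 < A) {f : ℕ → W.L2} (hf : Orthonormal ℂ f)
    {δ : ℕ → ℝ} (h1 : ∀ n, W.dispersion s (f n) ≤ ENNReal.ofReal (δ n))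
    (h2 : ∀ n, W.dispersion s (F.T (f n)) ≤ ENNReal.ofReal (A * (δ n)⁻¹)) :
    ∃ B : ℝ, ∀ t : ℝ, 0 < t → ∀ u : Finset ℕ, (∀ n ∈ u, t ≤ δ n ∧ δ n < 2 * t) →
      (u.card : ℝ) ≤ B := by
  have ha := W.a_pos
  obtain ⟨c, hc⟩ := F.bounded
  have hc' : ∀ x ∈ W.Ω, ∀ ξ ∈ W.Ω, ‖F.K x ξ‖ ≤ max c 0 :=
    fun x hx ξ hξ => (hc x hx ξ hξ).trans (le_max_left _ _)
  refine ⟨9 * ((max c 0 * ((∫ ζ, W.Q ζ ∂(sphereMeasure d)) / (2 * W.a))) ^ 2 *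
    ((18 * A) ^ (1 / s)) ^ (2 * W.a)), fun t ht u hu => ?_⟩
  -- For `t ≤ δ n < 2t` these radii make both tails at most `1/3`, so `1 ≤ 3 (m + 2/9)` and the
  -- localized mass `m` is at least `1/9`. In `r * r'` the scale `t` cancels, hence the bound is
  -- uniform.
  set r : ℝ := (6 * t) ^ (1 / s) with hr
  set r' : ℝ := (3 * A / t) ^ (1 / s) with hr'
  have hr0 : 0 < r := by positivity
  have hr0' : 0 < r' := by positivity
  have hrr : r * r' = (18 * A) ^ (1 / s) := by
    rw [hr, hr', ← Real.mul_rpow (by positivity) (by positivity)]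
    congr 1
    field_simp
    norm_num
  have hrs : r ^ (-s) = (6 * t)⁻¹ := by
    rw [Real.rpow_neg hr0.le, hr, ← Real.rpow_mul (by positivity), one_div_mul_cancel hs.ne',
      Real.rpow_one]
  have hrs' : r' ^ (-s) = (3 * A / t)⁻¹ := by
    rw [Real.rpow_neg hr0'.le, hr', ← Real.rpow_mul (by positivity), one_div_mul_cancel hs.ne',
      Real.rpow_one]
  have h3 := F.sum_ballMass_T_cutoff_le_ofReal hc' (le_max_right _ _) le_rfl hr0 hr0' hf u
  rw [hrr] at h3
  have h4 := ENNReal.toReal_le_of_le_ofReal (by positivity) h3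
  rw [ENNReal.toReal_sum fun n _ => W.ballMass_ne_top _ _] at h4
  have h5 : ∀ n ∈ u, (1 / 9 : ℝ) ≤ (W.ballMass r' (F.T (W.cutoff r (f n)))).toReal := by
    intro n hn
    obtain ⟨hn1, hn2⟩ := hu n hn
    have e1 : ENNReal.ofReal (r ^ (-s)) * W.dispersion s (f n) ≤ ENNReal.ofReal (1 / 3) := by
      refine (mul_le_mul_right (h1 n) _).trans ?_
      rw [← ENNReal.ofReal_mul (by positivity), hrs]
      refine ENNReal.ofReal_le_ofReal ?_
      rw [inv_mul_le_iff₀ (by positivity)]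
      linarith
    have e2 : ENNReal.ofReal (r' ^ (-s)) * W.dispersion s (F.T (f n)) ≤
        ENNReal.ofReal (1 / 3) := by
      refine (mul_le_mul_right (h2 n) _).trans ?_
      rw [← ENNReal.ofReal_mul (by positivity), hrs']
      refine ENNReal.ofReal_le_ofReal ?_
      rw [inv_mul_le_iff₀ (by positivity)]
      have : (δ n)⁻¹ ≤ t⁻¹ := inv_anti₀ ht hn1
      calc A * (δ n)⁻¹ ≤ A * t⁻¹ := by gcongr
        _ = 3 * A / t * (1 / 3) := by ring
    have e3 : (1 : ℝ≥0∞) ≤ 3 * (W.ballMass r' (F.T (W.cutoff r (f n))) +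
        ENNReal.ofReal (1 / 3) ^ 2 + ENNReal.ofReal (1 / 3) ^ 2) :=
      (F.one_le_ballMass_add_dispersion hr0 hr0' hs (hf.norm_eq_one n)).trans (by gcongr)
    rw [← ENNReal.ofReal_toReal (W.ballMass_ne_top r' (F.T (W.cutoff r (f n)))),
      ← ENNReal.ofReal_pow (by positivity), ← ENNReal.ofReal_add (by positivity) (by positivity),
      ← ENNReal.ofReal_add (by positivity) (by positivity),
      show (3 : ℝ≥0∞) = ENNReal.ofReal 3 by simp, ← ENNReal.ofReal_mul (by positivity),
      ← ENNReal.ofReal_one, ENNReal.ofReal_le_ofReal_iff (by positivity)] at e3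
    linarith
  have h6 := (Finset.card_nsmul_le_sum u _ _ h5).trans h4
  rw [nsmul_eq_mul] at h6
  linarith

/-- There is no orthonormal basis with bounded uncertainty products. -/
theorem not_bounded_dispersion_mul {s A : ℝ} (hs : 0 < s) (hA : 0 < A)
    (f : HilbertBasis ℕ ℂ W.L2) {δ : ℕ → ℝ} (hδ : ∀ n, 0 < δ n)
    (h1 : ∀ n, W.dispersion s (f n) ≤ ENNReal.ofReal (δ n))
    (h2 : ∀ n, W.dispersion s (F.T (f n)) ≤ ENNReal.ofReal (A * (δ n)⁻¹)) : False := by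
  have hf : Orthonormal ℂ f := f.orthonormal
  have hTf : Orthonormal ℂ fun n => F.T (f n) := hf.comp_linearIsometry F.T
  have hμ : W.μ ≠ 0 := by
    intro h0
    have h3 := hf.norm_eq_one 0
    have h4 : ∀ g : Euc d → ℂ, eLpNorm g 2 W.μ = 0 := fun g => by
      rw [h0, eLpNorm_measure_zero]
    rw [Lp.norm_def, h4] at h3
    simp at h3
  obtain ⟨B, hB⟩ := F.exists_card_le hs hA hf h1 h2
  have hsum := summable_min_sq_inv_sq hδ hB
  obtain ⟨g, hg, hgs⟩ := W.exists_orthonormal_shell hμ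
  have hgcut : ∀ j, W.cutoff 2 (g j) = g j := fun j => W.cutoff_eq_self (by
    filter_upwards [hgs j] with x hx h2x
    by_contra h0
    linarith [(hx h0).2])
  -- The `g j` lie in the ball of radius `2`, so the Hilbert-Schmidt bound makes these masses
  -- summable.
  have hcutT : Filter.Tendsto (fun j => ‖W.cutoff 1 (F.T (g j))‖ ^ 2) Filter.atTop (nhds 0) := by
    obtain ⟨c, hc⟩ := F.bounded
    have hc' : ∀ x ∈ W.Ω, ∀ ξ ∈ W.Ω, ‖F.K x ξ‖ ≤ max c 0 :=
      fun x hx ξ hξ => (hc x hx ξ hξ).trans (le_max_left _ _)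
    have ha := W.a_pos
    refine (summable_of_sum_le (c := (max c 0 * ((∫ ζ, W.Q ζ ∂(sphereMeasure d)) /
      (2 * W.a))) ^ 2 * (2 * 1) ^ (2 * W.a)) (fun j => by positivity)
        fun u => ?_).tendsto_atTop_zero
    have h3 := F.sum_ballMass_T_cutoff_le_ofReal hc' (le_max_right _ _) le_rfl two_pos one_pos
      hg u
    have h4 := ENNReal.toReal_le_of_le_ofReal (by positivity) h3
    rw [ENNReal.toReal_sum fun n _ => W.ballMass_ne_top _ _] at h4
    simpa only [W.toReal_ballMass, hgcut] using h4
  -- Only the tail of `f n` beyond radius `1` meets `g j`.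
  have hi : ∀ j n, ‖inner ℂ (f n) (g j)‖ ≤ δ n := by
    intro j n
    have h3 := W.inner_cutoff_eq_zero ((hgs j).mono fun x hx h0 => (hx h0).1) (f n)
    rw [norm_inner_symm, ← sub_zero (inner ℂ (g j) (f n)), ← h3, ← inner_sub_right]
    refine (norm_inner_le_norm _ _).trans ?_
    rw [hg.norm_eq_one, one_mul]
    simpa using W.norm_sub_cutoff_le one_pos hs (hδ n).le (h1 n)
  -- On the transform side, split `T (f n)` at radius `1`: its tail has norm at most `A / δ n`, and
  -- the cutoff moves over to `T (g j)`.
  have hii : ∀ j n, ‖inner ℂ (f n) (g j)‖ ^ 2 ≤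
      2 * ‖inner ℂ (F.T (f n)) (W.cutoff 1 (F.T (g j)))‖ ^ 2 + 2 * A ^ 2 * (δ n)⁻¹ ^ 2 := by
    intro j n
    have hA' : 0 ≤ A * (δ n)⁻¹ := mul_nonneg hA.le (inv_nonneg.2 (hδ n).le)
    have h3 : ‖inner ℂ (F.T (f n) - W.cutoff 1 (F.T (f n))) (F.T (g j))‖ ≤ A * (δ n)⁻¹ := by
      refine (norm_inner_le_norm _ _).trans ?_
      rw [F.T.norm_map, hg.norm_eq_one, mul_one]
      simpa using W.norm_sub_cutoff_le one_pos hs hA' (h2 n)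
    have h4 : ‖inner ℂ (f n) (g j)‖ ≤
        ‖inner ℂ (F.T (f n)) (W.cutoff 1 (F.T (g j)))‖ + A * (δ n)⁻¹ := by
      rw [← F.T.inner_map_map, ← W.inner_cutoff_comm]
      rw [inner_sub_left] at h3
      exact (norm_le_norm_add_norm_sub' _ _).trans (by gcongr)
    calc ‖inner ℂ (f n) (g j)‖ ^ 2 ≤ _ := pow_le_pow_left₀ (norm_nonneg _) h4 2
      _ ≤ 2 * (‖inner ℂ (F.T (f n)) (W.cutoff 1 (F.T (g j)))‖ ^ 2 + (A * (δ n)⁻¹) ^ 2) :=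
        add_sq_le
      _ = _ := by ring
  have hiii : ∀ j n, ‖inner ℂ (f n) (g j)‖ ^ 2 ≤
      2 * ‖inner ℂ (F.T (f n)) (W.cutoff 1 (F.T (g j)))‖ ^ 2 +
        (1 + 2 * A ^ 2) * min (δ n ^ 2) ((δ n)⁻¹ ^ 2) := by
    intro j n
    rcases min_choice (δ n ^ 2) ((δ n)⁻¹ ^ 2) with h | h <;> rw [h]
    · have h3 := pow_le_pow_left₀ (norm_nonneg _) (hi j n) 2
      nlinarith [sq_nonneg ‖inner ℂ (F.T (f n)) (W.cutoff 1 (F.T (g j)))‖,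
        mul_nonneg (sq_nonneg A) (sq_nonneg (δ n))]
    · linarith [hii j n, sq_nonneg (δ n)⁻¹]
  have hK : 0 < 1 + 2 * A ^ 2 := by positivity
  -- The finite set `u` does not depend on `j`; off `u` the `min` terms contribute at most `1/4`.
  obtain ⟨u, hu⟩ := summable_iff_vanishing_norm.1 hsum (1 / (4 * (1 + 2 * A ^ 2))) (by positivity)
  have hbound : ∀ j, 1 ≤ ∑ n ∈ u, ‖inner ℂ (f n) (g j)‖ ^ 2 +
      (2 * ‖W.cutoff 1 (F.T (g j))‖ ^ 2 + 1 / 4) := by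
    intro j
    have hp : HasSum (fun n => ‖inner ℂ (f n) (g j)‖ ^ 2) 1 := by
      have h3 := f.hasSum_inner_mul_inner (g j) (g j)
      rw [inner_self_eq_norm_sq_to_K, hg.norm_eq_one] at h3
      rw [← Complex.hasSum_ofReal]
      have h4 : ∀ n, inner ℂ (g j) (f n) * inner ℂ (f n) (g j) =
          ((‖inner ℂ (f n) (g j)‖ ^ 2 : ℝ) : ℂ) := fun n => by
        rw [← inner_conj_symm (g j) (f n), mul_comm, RCLike.mul_conj]
        simp
      simpa only [h4, RCLike.ofReal_one, one_pow, Complex.ofReal_one] using h3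
    refine le_of_tendsto hp (Filter.eventually_atTop.2 ⟨u, fun v hv => ?_⟩)
    rw [← Finset.sum_sdiff hv, add_comm]
    gcongr
    have h3 := hu (v \ u) Finset.sdiff_disjoint
    -- `T` is an isometry, so Bessel's inequality applies to the `T (f n)` as well.
    have h4 := hTf.sum_inner_products_le (W.cutoff 1 (F.T (g j))) (s := v \ u)
    have h5 := (Real.le_norm_self _).trans h3.le
    calc ∑ n ∈ v \ u, ‖inner ℂ (f n) (g j)‖ ^ 2 ≤ _ := Finset.sum_le_sum fun n _ => hiii j n
      _ = 2 * ∑ n ∈ v \ u, ‖inner ℂ (F.T (f n)) (W.cutoff 1 (F.T (g j)))‖ ^ 2 +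
          (1 + 2 * A ^ 2) * ∑ n ∈ v \ u, min (δ n ^ 2) ((δ n)⁻¹ ^ 2) := by
        rw [Finset.sum_add_distrib, Finset.mul_sum, Finset.mul_sum]
      _ ≤ 2 * ‖W.cutoff 1 (F.T (g j))‖ ^ 2 + (1 + 2 * A ^ 2) * (1 / (4 * (1 + 2 * A ^ 2))) := by
        gcongr
      _ = _ := by
        field_simp
  have hlim : Filter.Tendsto (fun j => ∑ n ∈ u, ‖inner ℂ (f n) (g j)‖ ^ 2 +
      (2 * ‖W.cutoff 1 (F.T (g j))‖ ^ 2 + 1 / 4)) Filter.atTop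
      (nhds (∑ n ∈ u, (0 : ℝ) + (2 * 0 + 1 / 4))) := by
    -- Orthonormal sequences tend weakly to `0`, so the sum over `u` vanishes in the limit and
    -- leaves `1 ≤ 1/4`.
    refine (tendsto_finsetSum _ fun n _ => ?_).add ((hcutT.const_mul 2).add_const _)
    simpa only [norm_inner_symm] using (hg.inner_products_summable (f n)).tendsto_atTop_zero
  have h7 := ge_of_tendsto' hlim hbound
  norm_num at h7

/-- The uncertainty products of an orthonormal basis are unbounded. -/
theorem iSup_dispersion_mul_eq_top {s : ℝ} (hs : 0 < s) (f : HilbertBasis ℕ ℂ W.L2) :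
    (⨆ n, W.dispersion s (f n) * W.dispersion s (F.T (f n))) = ⊤ := by
  by_contra htop
  set M := ⨆ n, W.dispersion s (f n) * W.dispersion s (F.T (f n)) with hM
  have hle : ∀ n, W.dispersion s (f n) * W.dispersion s (F.T (f n)) ≤ M :=
    le_iSup fun n => W.dispersion s (f n) * W.dispersion s (F.T (f n))
  have hf0 : ∀ n, W.dispersion s (f n) ≠ 0 := fun n =>
    W.dispersion_ne_zero s (f.orthonormal.ne_zero n)
  have hT0 : ∀ n, W.dispersion s (F.T (f n)) ≠ 0 := fun n =>
    W.dispersion_ne_zero s 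
      ((map_ne_zero_iff F.T F.T.injective).2 (f.orthonormal.ne_zero n))
  -- An infinite factor would force an infinite product, since the other factor is nonzero.
  have hft : ∀ n, W.dispersion s (f n) ≠ ⊤ := fun n h => by
    have := hle n
    rw [h, ENNReal.top_mul (hT0 n)] at this
    exact htop (top_le_iff.1 this)
  have hpos : ∀ n, 0 < (W.dispersion s (f n)).toReal := fun n =>
    ENNReal.toReal_pos (hf0 n) (hft n)
  refine F.not_bounded_dispersion_mul (A := M.toReal + 1) hs (by positivity) f hpos
    (fun n => (ENNReal.ofReal_toReal (hft n)).ge) fun n => ?_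
  rw [ENNReal.ofReal_mul (by positivity), ENNReal.ofReal_inv_of_pos (hpos n),
    ENNReal.ofReal_toReal (hft n), ← div_eq_mul_inv,
    ENNReal.le_div_iff_mul_le (Or.inl (hf0 n)) (Or.inl (hft n)), mul_comm]
  exact (hle n).trans (ENNReal.le_ofReal_iff_toReal_le htop (by positivity) |>.2 (by linarith))

end FourierLike

/-! ### The two statements combined. -/

theorem theoremA :
    (∀ s a c q : ℝ, 0 < s → ∃ C : ℝ, 0 < C ∧
      ∀ (d : ℕ) (W : WeightedCone d) (F : FourierLike W), W.a = a →
        (∀ x ∈ W.Ω, ∀ ξ ∈ W.Ω, ‖F.K x ξ‖ ≤ c) → (∫ ζ, W.Q ζ ∂(sphereMeasure d)) ≤ q →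
        ∀ f : ℕ → W.L2, Orthonormal ℂ f → ∀ N : ℕ, 1 ≤ N →
          ENNReal.ofReal (C * (N : ℝ) ^ (1 + s / (2 * a))) ≤
            ∑ n ∈ Finset.range N,
              (W.dispersion s (f n) ^ 2 + W.dispersion s (F.T (f n)) ^ 2)) ∧
    (∀ s : ℝ, 0 < s → ∀ (d : ℕ) (W : WeightedCone d) (F : FourierLike W)
      (f : HilbertBasis ℕ ℂ W.L2),
        (⨆ n, W.dispersion s (f n) * W.dispersion s (F.T (f n))) = ⊤) := by
  refine ⟨fun s a c q hs => ?_, fun s hs d W F f => F.iSup_dispersion_mul_eq_top hs f⟩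
  by_cases ha : 0 < a
  · have hc0 : 0 < max c 1 := by positivity
    have hq0 : 0 < max q 1 := by positivity
    refine ⟨(6 * (max c 1 * (max q 1 / (2 * a))) ^ 2) ^ (-(s / (2 * a))) / 6, by positivity, ?_⟩
    rintro d W F rfl hc hq f hf N hN
    exact F.le_sum_dispersion_sq hs (fun x hx ξ hξ => (hc x hx ξ hξ).trans (le_max_left _ _)) hc0
      (hq.trans (le_max_left _ _)) hq0 hf hN
  · exact ⟨1, one_pos, fun d W F hW => absurd (hW ▸ W.a_pos) ha⟩
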